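/- Let $h$ be the morphism on words over $\{0,1\}$ given by $h(1)=110$, $h(0)=11$, and let $\mathbf k = k_1k_2k_3\cdots = 1101101111\cdots$ be the infinite word (indexed from $1$) of which all the finite words $h^n(1)$, $n\ge 0$, are prefixes. For $n\ge 1$ let $A_n$ be the position of the $n$-th $1$ in $\mathbf k$ and $B_n$ the position of the $n$-th $0$ in $\mathbf k$, and set $A_0=B_0=0$. Then for all $n\ge 0$ we have $A_{B_n}\in\{A_n+B_n-1,\ A_n+B_n\}$. -/

import Mathlib

namespace Kimberling

/-- The morphism `1 → 110`, `0 → 11` on single letters. -/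
def h : Fin 2 → List (Fin 2)
  | 0 => [1, 1]
  | 1 => [1, 1, 0]

/-- The extension of the morphism to finite words, by concatenation. -/
def hWord (w : List (Fin 2)) : List (Fin 2) := w.flatMap h

/-- The finite words `K_n = h^n(1)`. -/
def K (n : ℕ) : List (Fin 2) := hWord^[n] [1]

theorem K_zero : K 0 = [1] := rfl

theorem K_succ (n : ℕ) : K (n + 1) = hWord (K n) := by
  simp only [K, Function.iterate_succ_apply']

theorem hWord_append (u v : List (Fin 2)) : hWord (u ++ v) = hWord u ++ hWord v := by
  simp [hWord]

theorem K_add_two (n : ℕ) : K (n + 2) = K (n + 1) ++ K (n + 1) ++ K n ++ K n := by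
  induction n with
  | zero => decide
  | succ n ih =>
    have e := congrArg hWord ih
    simpa only [hWord_append, ← K_succ] using e

theorem K_prefix_succ (n : ℕ) : K n <+: K (n + 1) := by
  cases n with
  | zero => exact ⟨[1, 0], rfl⟩
  | succ n => exact ⟨K (n + 1) ++ K n ++ K n, by rw [K_add_two]; simp⟩

theorem K_prefix {m n : ℕ} (hmn : m ≤ n) : K m <+: K n := by
  induction n, hmn using Nat.le_induction with
  | base => exact List.prefix_rfl
  | succ n _ ih => exact ih.trans (K_prefix_succ n)

theorem lt_length_K (n : ℕ) : n < (K n).length := by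
  induction n using Nat.twoStepInduction with
  | zero => decide
  | one => decide
  | more n ih1 ih2 =>
    rw [K_add_two]
    simp only [List.length_append]
    omega

/-- The infinite word `k = k_1 k_2 k_3 ⋯` of which all the `K_n` are prefixes, indexed from `1`:
`k i` is the `i`-th letter of `K_i` (which has more than `i` letters). The value at `0` is
irrelevant. -/
def k (i : ℕ) : Fin 2 :=
  (K i)[i - 1]'(lt_of_le_of_lt (Nat.sub_le i 1) (lt_length_K i))

/-- Every `K_n` is a prefix of `k`. -/
theorem k_eq_getElem (n i : ℕ) (hi : 1 ≤ i) (hin : i ≤ (K n).length) :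
    k i = (K n)[i - 1]'(by omega) := by
  unfold k
  rcases le_total i n with hle | hle
  · exact (K_prefix hle).getElem _
  · exact ((K_prefix hle).getElem _).symm

/-- The letter `1` occurs infinitely often in `k`. -/
theorem infinite_ones : {i : ℕ | 1 ≤ i ∧ k i = 1}.Infinite := by
  rw [Set.infinite_iff_exists_gt]
  intro n
  have hl := lt_length_K (n + 1)
  have h1 : [1, 1, 0] <+: K (n + 1) := K_prefix (m := 1) (by omega)
  have h2 : K (n + 1) ++ [1, 1, 0] <+: K (n + 2) := by
    rw [K_add_two]
    simp only [List.append_assoc]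
    exact (List.prefix_append_right_inj _).2 (h1.trans (List.prefix_append _ _))
  have hlen := h2.length_le
  simp only [List.length_append, List.length_cons, List.length_nil] at hlen
  refine ⟨(K (n + 1)).length + 1, ⟨by omega, ?_⟩, by omega⟩
  rw [k_eq_getElem (n + 2) _ (by omega) (by omega), ← h2.getElem (by simp)]
  simp

/-- The letter `0` occurs infinitely often in `k`. -/
theorem infinite_zeros : {i : ℕ | 1 ≤ i ∧ k i = 0}.Infinite := by
  rw [Set.infinite_iff_exists_gt]
  intro n
  have hl := lt_length_K (n + 1)
  have h1 : [1, 1, 0] <+: K (n + 1) := K_prefix (m := 1) (by omega)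
  have h2 : K (n + 1) ++ [1, 1, 0] <+: K (n + 2) := by
    rw [K_add_two]
    simp only [List.append_assoc]
    exact (List.prefix_append_right_inj _).2 (h1.trans (List.prefix_append _ _))
  have hlen := h2.length_le
  simp only [List.length_append, List.length_cons, List.length_nil] at hlen
  refine ⟨(K (n + 1)).length + 3, ⟨by omega, ?_⟩, by omega⟩
  rw [k_eq_getElem (n + 2) _ (by omega) (by omega), ← h2.getElem (by simp)]
  simp

/-- `A n` is the position of the `n`-th `1` in `k` for `n ≥ 1`, and `A 0 = 0`.
(`Nat.nth p` counts from `0`; there are infinitely many ones by `infinite_ones`.) -/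
noncomputable def A (n : ℕ) : ℕ :=
  if n = 0 then 0 else Nat.nth (fun i => 1 ≤ i ∧ k i = 1) (n - 1)

/-- `B n` is the position of the `n`-th `0` in `k` for `n ≥ 1`, and `B 0 = 0`.
(`Nat.nth p` counts from `0`; there are infinitely many zeros by `infinite_zeros`.) -/
noncomputable def B (n : ℕ) : ℕ :=
  if n = 0 then 0 else Nat.nth (fun i => 1 ≤ i ∧ k i = 0) (n - 1)

end Kimberling

/-! The word is fixed by the morphism and each block `h a` starts with `11`, so `A (n + 1) = n + 1 +
ones (n / 2)`; a `0` closes exactly the blocks of `1`s, so `B n = 2 * A n + n`. With `m = n / 2`,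
the claim for `n + 1` becomes `m ≤ zeros (A (n + 1) + m) ≤ m + 1`. Locating zeros through `B`
reduces this to comparing `ones (2 * i)` with `2 * ones i`, which `discrepancy_ones` does by
desubstitution. -/

namespace Kimberling

/-- The number of ones among the first `x` letters of `k`. -/
def ones (x : ℕ) : ℕ := Nat.count (fun i => 1 ≤ i ∧ k i = 1) (x + 1)

/-- The number of zeros among the first `x` letters of `k`. -/
def zeros (x : ℕ) : ℕ := Nat.count (fun i => 1 ≤ i ∧ k i = 0) (x + 1)

theorem ones_zero : ones 0 = 0 := by simp [ones, Nat.count_succ]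

theorem zeros_zero : zeros 0 = 0 := by simp [zeros, Nat.count_succ]

theorem ones_succ (x : ℕ) : ones (x + 1) = ones x + if k (x + 1) = 1 then 1 else 0 := by
  simp [ones, Nat.count_succ _ (x + 1)]

theorem zeros_succ (x : ℕ) : zeros (x + 1) = zeros x + if k (x + 1) = 0 then 1 else 0 := by
  simp [zeros, Nat.count_succ _ (x + 1)]

theorem ones_add_zeros (x : ℕ) : ones x + zeros x = x := by
  induction x with
  | zero => simp [ones_zero, zeros_zero]
  | succ x ih =>
    rw [ones_succ, zeros_succ]
    have : k (x + 1) = 0 ∨ k (x + 1) = 1 := by omega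
    rcases this with e | e <;> simp [e] <;> omega

theorem ones_succ_eq_or (x : ℕ) : ones (x + 1) = ones x ∨ ones (x + 1) = ones x + 1 := by
  rw [ones_succ]
  split_ifs <;> simp

theorem ones_mono {x y : ℕ} (hxy : x ≤ y) : ones x ≤ ones y :=
  Nat.count_monotone _ (by omega)

theorem zeros_mono {x y : ℕ} (hxy : x ≤ y) : zeros x ≤ zeros y :=
  Nat.count_monotone _ (by omega)

theorem A_eq_of_ones {x m : ℕ} (h0 : ones x = m) (h1 : ones (x + 1) = m + 1) :
    A (m + 1) = x + 1 := by
  rw [ones_succ] at h1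
  have hk : k (x + 1) = 1 := by
    by_contra hne
    simp only [hne, if_false] at h1
    omega
  rw [A, if_neg (by omega), Nat.add_sub_cancel, ← h0, ones]
  exact Nat.nth_count (p := fun i => 1 ≤ i ∧ k i = 1) ⟨by omega, hk⟩

theorem B_eq_of_zeros {x m : ℕ} (h0 : zeros x = m) (h1 : zeros (x + 1) = m + 1) :
    B (m + 1) = x + 1 := by
  rw [zeros_succ] at h1
  have hk : k (x + 1) = 0 := by
    by_contra hne
    simp only [hne, if_false] at h1
    omega
  rw [B, if_neg (by omega), Nat.add_sub_cancel, ← h0, zeros]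
  exact Nat.nth_count (p := fun i => 1 ≤ i ∧ k i = 0) ⟨by omega, hk⟩

theorem ones_length_of_prefix {n : ℕ} {u : List (Fin 2)} (hu : u <+: K n) :
    ones u.length = u.count 1 := by
  induction u using List.reverseRecOn with
  | nil => simp [ones_zero]
  | append_singleton u a ih =>
    have hlen := hu.length_le
    simp only [List.length_append, List.length_singleton] at hlen
    have hk : k (u.length + 1) = a := by
      rw [k_eq_getElem n _ (by omega) hlen, ← hu.getElem (by simp)]
      simp
    rw [List.length_append, List.length_singleton, ones_succ, hk,
      ih ((List.prefix_append _ _).trans hu), List.count_append, List.count_singleton]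
    simp

theorem length_hWord (u : List (Fin 2)) : (hWord u).length = 2 * u.length + u.count 1 := by
  induction u with
  | nil => rfl
  | cons a u ih =>
    rw [← List.singleton_append, hWord_append, List.length_append, ih]
    fin_cases a <;> simp [hWord, h] <;> omega

theorem count_one_hWord (u : List (Fin 2)) : (hWord u).count 1 = 2 * u.length := by
  induction u with
  | nil => rfl
  | cons a u ih =>
    rw [← List.singleton_append, hWord_append, List.count_append, ih]
    fin_cases a <;> simp [hWord, h] <;> omega

/-- Every letter of `k` contributes a block starting with `11` and with exactly two ones. -/
theorem ones_image (j : ℕ) {r : ℕ} (hr : r ≤ 2) : ones (2 * j + ones j + r) = 2 * j + r := by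
  have hj := lt_length_K j
  set u := (K j).take j with hu
  have hul : u.length = j := by simp [hu, hj.le]
  have hup : u <+: K j := List.take_prefix _ _
  have hc : ones j = u.count 1 := by rw [← ones_length_of_prefix hup, hul]
  have hblock : [1, 1] <+: h (K j)[j] := by
    generalize (K j)[j] = a
    fin_cases a
    · exact ⟨[], rfl⟩
    · exact ⟨[0], rfl⟩
  have hpre : hWord u ++ [1, 1] <+: K (j + 1) := by
    have e : K j = u ++ ((K j)[j] :: (K j).drop (j + 1)) := by
      rw [hu, ← List.drop_eq_getElem_cons, List.take_append_drop]
    rw [K_succ]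
    conv_rhs => rw [e]
    rw [hWord_append, List.prefix_append_right_inj]
    rw [hWord, List.flatMap_cons]
    exact hblock.trans (List.prefix_append _ _)
  have hrep : hWord u ++ List.replicate r 1 <+: K (j + 1) := by
    refine List.IsPrefix.trans ?_ hpre
    rw [List.prefix_append_right_inj]
    interval_cases r
    · exact ⟨[1, 1], rfl⟩
    · exact ⟨[1], rfl⟩
    · exact ⟨[], rfl⟩
  have := ones_length_of_prefix hrep
  simpa [length_hWord, count_one_hWord, hul, ← hc] using this

/-- Every position lies in the block of some letter; the third place of a block is present only for
the letter `1`. -/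
theorem exists_block (x : ℕ) : ∃ j r, x = 2 * j + ones j + r ∧
    (r ≤ 1 ∨ r = 2 ∧ ones (j + 1) = ones j + 1) := by
  induction x with
  | zero => exact ⟨0, 0, by simp [ones_zero], by omega⟩
  | succ x ih =>
    obtain ⟨j, r, hx, hr⟩ := ih
    have := ones_succ_eq_or j
    by_cases hlast : r = 0 ∨ r = 1 ∧ ones (j + 1) = ones j + 1
    · exact ⟨j, r + 1, by omega, by omega⟩
    · exact ⟨j + 1, 0, by omega, by omega⟩

/-- The constraints on `d = v - 2 * u` and `e = ones v - 2 * ones u`. -/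
def Discrepancy (d e : ℤ) : Prop :=
  (-1 ≤ d → -3 ≤ e) ∧ (0 ≤ d → -2 ≤ e) ∧ (1 ≤ d → -1 ≤ e) ∧ (2 ≤ d → 0 ≤ e) ∧
    (d ≤ 2 → e ≤ 3) ∧ (d ≤ 1 → e ≤ 2) ∧ (d ≤ -1 → e ≤ 1)

/-- The single bounds needed later are not inductive; this system is closed under passing from
letters to blocks. An offset of `2` occurs only in the block of a `1`, so the bounds after that
letter are also available. -/
theorem discrepancy_image {d e r s : ℤ} (hde : Discrepancy d e)
    (hr : 0 ≤ r ∧ r ≤ 1 ∨ r = 2 ∧ Discrepancy (d - 2) (e - 2))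
    (hs : 0 ≤ s ∧ s ≤ 1 ∨ s = 2 ∧ Discrepancy (d + 1) (e + 1)) :
    Discrepancy (2 * d + e + s - 2 * r) (2 * d + s - 2 * r) := by
  unfold Discrepancy at *
  have hr' : r = 0 ∨ r = 1 ∨ r = 2 := by omega
  have hs' : s = 0 ∨ s = 1 ∨ s = 2 := by omega
  rcases hr' with rfl | rfl | rfl <;> rcases hs' with rfl | rfl | rfl <;> omega

theorem discrepancy_ones (u v : ℕ) :
    Discrepancy ((v : ℤ) - 2 * u) ((ones v : ℤ) - 2 * ones u) := by
  induction hN : u + v using Nat.strong_induction_on generalizing u v with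
  | _ N ih =>
    subst hN
    rcases Nat.eq_zero_or_pos (u + v) with h0 | hpos
    · obtain ⟨rfl, rfl⟩ : u = 0 ∧ v = 0 := by omega
      simp [ones_zero, Discrepancy]
    obtain ⟨i, r, hu, hr⟩ := exists_block u
    obtain ⟨j, s, hv, hs⟩ := exists_block v
    have hou : ones u = 2 * i + r := by rw [hu, ones_image i (by omega)]
    have hov : ones v = 2 * j + s := by rw [hv, ones_image j (by omega)]
    -- Desubstitute both prefixes; the sum of lengths still drops when one of `i`, `j` is advanced
    -- by a letter.
    have key := discrepancy_image (r := r) (s := s) (ih (i + j) (by omega) i j rfl)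
      (hr.imp (fun h => by omega) fun h => ⟨by omega, by
        convert ih (i + 1 + j) (by omega) (i + 1) j rfl using 1
        · push_cast; ring
        · rw [h.2]; push_cast; ring⟩)
      (hs.imp (fun h => by omega) fun h => ⟨by omega, by
        convert ih (i + (j + 1)) (by omega) i (j + 1) rfl using 1
        · push_cast; ring
        · rw [h.2]; push_cast; ring⟩)
    convert key using 1
    · rw [hu, hv]; push_cast; ring
    · rw [hou, hov]; push_cast; ring

theorem two_mul_ones_le (i : ℕ) : 2 * ones i ≤ ones (2 * i + 1) + 1 := by
  have := (discrepancy_ones i (2 * i + 1)).2.2.1 (by push_cast; omega)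
  omega

theorem ones_two_mul_le (i : ℕ) : ones (2 * i) ≤ 2 * ones i + 2 := by
  have := (discrepancy_ones i (2 * i)).2.2.2.2.2.1 (by push_cast; omega)
  omega

theorem A_two_mul_add (j : ℕ) {r : ℕ} (hr : r ≤ 1) :
    A (2 * j + r + 1) = 2 * j + ones j + r + 1 :=
  A_eq_of_ones (ones_image j (by omega)) (ones_image j (r := r + 1) (by omega))

theorem A_succ (n : ℕ) : A (n + 1) = n + 1 + ones (n / 2) := by
  have := A_two_mul_add (n / 2) (r := n % 2) (by omega)
  rw [Nat.div_add_mod] at this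
  omega

theorem ones_A_succ (n : ℕ) : ones (A (n + 1)) = n + 1 := by
  have h1 := ones_image (n / 2) (r := n % 2 + 1) (by omega)
  rw [A_succ, show n + 1 + ones (n / 2) = 2 * (n / 2) + ones (n / 2) + (n % 2 + 1) by omega, h1]
  omega

theorem zeros_two_mul_A_succ (n : ℕ) : zeros (2 * A (n + 1) + n + 1) = n + 1 := by
  have h1 := ones_image (A (n + 1)) (r := 0) (by omega)
  rw [ones_A_succ] at h1
  have := ones_add_zeros (2 * A (n + 1) + n + 1)
  simp only [← add_assoc, add_zero] at h1
  omega

/-- This prefix stops after the `11` of the block of the `(n + 1)`-th `1`, just before its closing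
`0`. -/
theorem zeros_two_mul_A_succ' (n : ℕ) : zeros (2 * A (n + 1) + n) = n := by
  have hA := A_succ n
  obtain ⟨a, ha⟩ : ∃ a, A (n + 1) = a + 1 := ⟨n + ones (n / 2), by omega⟩
  have hone : ones a = n := by
    have h0 := ones_image (n / 2) (r := n % 2) (by omega)
    rw [show a = 2 * (n / 2) + ones (n / 2) + n % 2 by omega, h0]
    omega
  have h1 := ones_image a (r := 2) le_rfl
  rw [hone, show 2 * a + n + 2 = 2 * A (n + 1) + n by omega] at h1
  have := ones_add_zeros (2 * A (n + 1) + n)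
  omega

theorem B_succ (n : ℕ) : B (n + 1) = 2 * A (n + 1) + n + 1 :=
  B_eq_of_zeros (zeros_two_mul_A_succ' n) (zeros_two_mul_A_succ n)

theorem le_zeros (n : ℕ) {x : ℕ} (hx : 3 * n + ones n + 1 ≤ x) : n ≤ zeros x := by
  cases n with
  | zero => omega
  | succ n =>
    rw [← zeros_two_mul_A_succ n]
    apply zeros_mono
    have h1 := two_mul_ones_le (n / 2)
    have h2 : ones (2 * (n / 2) + 1) ≤ ones (n + 1) := ones_mono (by omega)
    have h3 := A_succ n
    omega

theorem zeros_le (n : ℕ) {x : ℕ} (hx : x ≤ 3 * n + ones n + 2) : zeros x ≤ n + 1 := by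
  -- Compare `x` with the position just before the `(n + 2)`-th `0`.
  rw [← zeros_two_mul_A_succ' (n + 1)]
  apply zeros_mono
  have h1 := ones_two_mul_le ((n + 1) / 2)
  have h2 : ones n ≤ ones (2 * ((n + 1) / 2)) := ones_mono (by omega)
  have h3 := A_succ (n + 1)
  omega

end Kimberling

theorem theorem5 (n : ℕ) :
    (Kimberling.A (Kimberling.B n) : ℤ) ∈
      ({(Kimberling.A n : ℤ) + (Kimberling.B n : ℤ) - 1,
        (Kimberling.A n : ℤ) + (Kimberling.B n : ℤ)} : Set ℤ) := by
  open Kimberling in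
  simp only [Set.mem_insert_iff, Set.mem_singleton_iff]
  cases n with
  | zero => simp [A, B]
  | succ n =>
    have hA := A_succ n
    have hB := A_succ (2 * A (n + 1) + n)
    rw [← B_succ] at hB
    -- By `A_succ` this argument is `3 * (n / 2) + ones (n / 2)` plus `1` or `2`, by the parity of
    -- `n`: the two bounds on `zeros` just cover it.
    have hq : (2 * A (n + 1) + n) / 2 = A (n + 1) + n / 2 := by omega
    rw [hq] at hB
    have h1 := le_zeros (n / 2) (x := A (n + 1) + n / 2) (by omega)
    have h2 := zeros_le (n / 2) (x := A (n + 1) + n / 2) (by omega)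
    have h3 := ones_add_zeros (A (n + 1) + n / 2)
    have h4 := B_succ n
    omega
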